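/- \textbf{Theorem (Abstract max flow/min cut over time).} Let $E$ be a finite set and let $\mathcal{P}$ be a finite family of nonempty subsets $P\subseteq E$ (``paths''), each equipped with a linear order $<_P$, such that for all $P,Q\in\mathcal{P}$ and $e\in P\cap Q$ there is a path $$P\times_e Q\ \subseteq\ \{p\in P: p\le_P e\}\cup\{q\in Q: q\ge_Q e\},\qquad P\times_e Q\in\mathcal{P}.$$ Let $c\in\mathbb{R}_{\ge 0}^E$ be capacities, $\tau\in\mathbb{Z}_{\ge 0}^E$ transit times, $T\in\mathbb{Z}_{\ge 0}$ a time horizon, and $\mathcal{T}=\{0,\dots,T-1\}$. For $e\in P$ let $(P,e)=\{p\in P: p<_P e\}$. A temporal path is a pair $P_t$ with $P\in\mathcal{P}$, $t\in\mathcal{T}$ and $t+\sum_{p\in P}\tau(p)<T$; it is identified with the set of all $(e,\theta)\in E\times\mathcal{T}$ such that $e\in P$ and $\theta=t+\sum_{p\in(P,e)}\tau(p)$. An abstract flow over time is an assignment $x\ge 0$ of values to the temporal paths with $\sum_{P_t\ni(e,\theta)}x(P_t)\le c(e)$ for all $(e,\theta)\in E\times\mathcal{T}$; its value is $\sum_{P_t}x(P_t)$.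 An abstract cut over time is a set $C\subseteq E\times\mathcal{T}$ that meets every temporal path; its capacity is $\sum_{(e,\theta)\in C}c(e)$. Then a maximum abstract flow over time and a minimum abstract cut over time exist, and the value of the former equals the capacity of the latter. Moreover, put $r(P)=T-\sum_{e\in P}\tau(e)$ for $P\in\mathcal{P}$ and consider the static maximum weighted abstract flow problem $$\max\Big\{\sum_{P\in\mathcal{P}}r(P)\tilde x(P):\ \tilde x\ge 0,\ \sum_{P\ni e}\tilde x(P)\le c(e)\ \ \forall e\in E\Big\}$$ and its dual $$\min\Big\{\sum_{e\in E}c(e)\tilde y(e):\ \tilde y\ge 0,\ \sum_{e\in P}\tilde y(e)\ge r(P)\ \ \forall P\in\mathcal{P}\Big\}.$$ \begin{enumerate} \item The weights are supermodular: $r(P\times_e Q)+r(Q\times_e P)\ge r(P)+r(Q)$ for all $P,Q\in\mathcal{P}$ and $e\in P\cap Q$, for every admissible choice of the two switched paths. \item The static problem has an optimal solution, and its dual has an optimal solution that is integral. \item For every optimal static flow $\tilde x$, the temporally repeated flow $x(P_t)=\tilde x(P)$ (for all temporal paths $P_t$, i.e. for $0\le t<r(P)$) is a maximum abstract flow over time,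 and its value is $\sum_{P}r(P)\tilde x(P)$. \item For every integral optimal dual solution $\tilde y$, the set $$C=\{(e,\theta)\in E\times\mathcal{T}:\ \alpha(e)\le\theta<\alpha(e)+\tilde y(e)\},\qquad \alpha(e)=\min_{P\in\mathcal{P}:\,e\in P}\ \sum_{p\in(P,e)}(\tau(p)+\tilde y(p)),$$ (with $\alpha(e)=0$ if $e$ lies on no path) is a minimum abstract cut over time, and its capacity is $\sum_{e\in E}c(e)\tilde y(e)$. \end{enumerate} -/

import Mathlib

/-- An abstract network on the ground set `E`: a family of linearly ordered subsets of `E`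
("paths"), indexed by `Path`, that has the switching property. -/
structure AbstractNetwork (E : Type*) (Path : Type*) where
  /-- the set of elements of a path -/
  elems : Path → Finset E
  /-- `lt P a b` means that `a` comes strictly before `b` on `P`; only its values on the
  elements of `P` are meaningful -/
  lt : Path → E → E → Prop
  lt_irrefl : ∀ P, ∀ a ∈ elems P, ¬ lt P a a
  lt_trans : ∀ P, ∀ a ∈ elems P, ∀ b ∈ elems P, ∀ d ∈ elems P, lt P a b → lt P b d → lt P a d
  lt_trichotomy : ∀ P, ∀ a ∈ elems P, ∀ b ∈ elems P, lt P a b ∨ a = b ∨ lt P b a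
  /-- the switching property: if `e` lies on `P` and `Q`, some path is contained in
  `{p ∈ P : p ≤_P e} ∪ {q ∈ Q : q ≥_Q e}` -/
  switching : ∀ P Q : Path, ∀ e, e ∈ elems P → e ∈ elems Q →
    ∃ R : Path, ∀ a ∈ elems R,
      (a ∈ elems P ∧ (lt P a e ∨ a = e)) ∨ (a ∈ elems Q ∧ (a = e ∨ lt Q e a))

namespace AbstractNetwork

variable {E Path : Type*}

/-- `R` is an admissible choice for the path `P ×_e Q`. -/
def IsSwitch (N : AbstractNetwork E Path) (P Q : Path) (e : E) (R : Path) : Prop :=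
  ∀ a ∈ N.elems R,
    (a ∈ N.elems P ∧ (N.lt P a e ∨ a = e)) ∨ (a ∈ N.elems Q ∧ (a = e ∨ N.lt Q e a))

/-- `r (P ×_e Q) + r (Q ×_e P) ≥ r P + r Q`, for all admissible choices of the two switched
paths. -/
def IsSupermodular (N : AbstractNetwork E Path) (r : Path → ℝ) : Prop :=
  ∀ P Q : Path, ∀ e, e ∈ N.elems P → e ∈ N.elems Q →
    ∀ R S : Path, N.IsSwitch P Q e R → N.IsSwitch Q P e S → r P + r Q ≤ r R + r S

/-! ### The static problem and its dual -/

open Classical in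
/-- Feasible static abstract flows. -/
def IsFlow [Fintype Path] (N : AbstractNetwork E Path) (c : E → ℝ) (x : Path → ℝ) : Prop :=
  (∀ P, 0 ≤ x P) ∧ ∀ e, ∑ P with e ∈ N.elems P, x P ≤ c e

/-- Optimal solutions of the maximum weighted abstract flow problem with weights `r`. -/
def IsMaxWeightedFlow [Fintype Path] (N : AbstractNetwork E Path) (c : E → ℝ) (r : Path → ℝ)
    (x : Path → ℝ) : Prop :=
  N.IsFlow c x ∧ ∀ x' : Path → ℝ, N.IsFlow c x' → ∑ P, r P * x' P ≤ ∑ P, r P * x P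

/-- Feasible solutions of the dual, the weighted abstract cut problem with weights `r`. -/
def IsWeightedCut (N : AbstractNetwork E Path) (r : Path → ℝ) (y : E → ℝ) : Prop :=
  (∀ e, 0 ≤ y e) ∧ ∀ P, r P ≤ ∑ e ∈ N.elems P, y e

/-- Optimal solutions of the minimum weighted abstract cut problem, among all real-valued
feasible solutions. -/
def IsMinWeightedCut [Fintype E] (N : AbstractNetwork E Path) (c : E → ℝ) (r : Path → ℝ)
    (y : E → ℝ) : Prop :=
  N.IsWeightedCut r y ∧ ∀ y' : E → ℝ, N.IsWeightedCut r y' → ∑ e, c e * y e ≤ ∑ e, c e * y' e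

/-! ### The time expansion -/

open Classical in
/-- The elements of `P` strictly before `e`. -/
noncomputable def before (N : AbstractNetwork E Path) (P : Path) (e : E) : Finset E :=
  {p ∈ N.elems P | N.lt P p e}

/-- The temporal paths `P_t`, for a path `P` and a starting time `t ∈ {0, …, T - 1}` such that
`P_t` arrives before time `T`. -/
abbrev TemporalPath (N : AbstractNetwork E Path) (τ : E → ℕ) (T : ℕ) : Type _ :=
  {p : Path × Fin T // (p.2 : ℕ) + ∑ e ∈ N.elems p.1, τ e < T}

/-- The set of temporal elements of the temporal path `P_t`, as a subset of
`E × {0, …, T - 1}`. -/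
def temporalElems (N : AbstractNetwork E Path) {τ : E → ℕ} {T : ℕ} (p : N.TemporalPath τ T) :
    Set (E × Fin T) :=
  {z | z.1 ∈ N.elems p.1.1 ∧ (z.2 : ℕ) = p.1.2 + ∑ a ∈ N.before p.1.1 z.1, τ a}

open Classical in
/-- Feasible abstract flows over time. -/
def IsFlowOverTime [Fintype Path] (N : AbstractNetwork E Path) (c : E → ℝ) (τ : E → ℕ) (T : ℕ)
    (x : N.TemporalPath τ T → ℝ) : Prop :=
  (∀ p, 0 ≤ x p) ∧
    ∀ (e : E) (θ : Fin T), ∑ p with (e, θ) ∈ N.temporalElems p, x p ≤ c e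

/-- Maximum abstract flows over time. -/
def IsMaxFlowOverTime [Fintype Path] (N : AbstractNetwork E Path) (c : E → ℝ) (τ : E → ℕ)
    (T : ℕ) (x : N.TemporalPath τ T → ℝ) : Prop :=
  N.IsFlowOverTime c τ T x ∧
    ∀ x' : N.TemporalPath τ T → ℝ, N.IsFlowOverTime c τ T x' → ∑ p, x' p ≤ ∑ p, x p

/-- Abstract cuts over time: sets of temporal elements that meet every temporal path. -/
def IsCutOverTime (N : AbstractNetwork E Path) (τ : E → ℕ) (T : ℕ)
    (C : Finset (E × Fin T)) : Prop :=
  ∀ p : N.TemporalPath τ T, ∃ z ∈ C, z ∈ N.temporalElems p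

/-- Abstract cuts over time of minimum capacity. -/
def IsMinCutOverTime (N : AbstractNetwork E Path) (c : E → ℝ) (τ : E → ℕ) (T : ℕ)
    (C : Finset (E × Fin T)) : Prop :=
  N.IsCutOverTime τ T C ∧
    ∀ C' : Finset (E × Fin T), N.IsCutOverTime τ T C' → ∑ z ∈ C, c z.1 ≤ ∑ z ∈ C', c z.1

/-! ### The construction from the static problem -/

/-- The weights `r(P) = T - ∑_{e ∈ P} τ(e)`; they may be negative. -/
def weight (N : AbstractNetwork E Path) (τ : E → ℕ) (T : ℕ) (P : Path) : ℝ :=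
  (T : ℝ) - ∑ e ∈ N.elems P, (τ e : ℝ)

/-- The temporally repeated flow of a static flow: `x(P_t) = x(P)` for every temporal path
`P_t`, that is, whenever `0 ≤ t < T - ∑_{e ∈ P} τ(e)`. -/
def temporallyRepeated (N : AbstractNetwork E Path) (τ : E → ℕ) (T : ℕ) (x : Path → ℝ) :
    N.TemporalPath τ T → ℝ :=
  fun p => x p.1.1

/-- The time `α(e)` at which `e` enters the cut: the minimum of `∑_{p ∈ (P, e)} (τ(p) + y(p))`
over all paths `P` that contain `e` (and `0` if there is no such path). -/
noncomputable def entryTime (N : AbstractNetwork E Path) (τ y : E → ℕ) (e : E) : ℕ :=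
  sInf {n | ∃ P, e ∈ N.elems P ∧ n = ∑ p ∈ N.before P e, (τ p + y p)}

open Classical in
/-- The set of all `(e, θ)` with `α(e) ≤ θ < α(e) + y(e)`. -/
noncomputable def cutOverTime [Fintype E] (N : AbstractNetwork E Path) (τ : E → ℕ) (T : ℕ)
    (y : E → ℕ) : Finset (E × Fin T) :=
  {z | N.entryTime τ y z.1 ≤ (z.2 : ℕ) ∧ (z.2 : ℕ) < N.entryTime τ y z.1 + y z.1}

end AbstractNetwork

/-! The heart is `exists_mem_entry_le_lt`: if `y` covers the weights `r`, every temporal path meets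
some `e` inside its window `[α e, α e + y e)`. If `P` missed all windows, let `i` be the last
element of `P` whose window is over on arrival, and switch at `i` from a path attaining `α i` to
`P`. The switched path either opens the window of a later element of `P` in time, contradicting the
choice of `i`, or it is shorter than `T`.

The argument allows real starting times, which also gives integrality of the dual: counting the
points of the shifted lattice `ℤ + k/n` in the windows of a real solution `y` gives an integral
solution, and averaging over `k < n` costs at most `c · y` plus an error of order `1/n`. Hahn–Banach
supplies a static flow of the same value as an optimal dual solution.

Finally, static value ≤ repeated flow ≤ cut over time ≤ dual value, and the two ends agree. -/

namespace AbstractNetwork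

variable {E Path : Type*}

/-! ### Orders on paths, entry times and the switching argument -/

section Order

variable (N : AbstractNetwork E Path)

lemma mem_before {P : Path} {a e : E} : a ∈ N.before P e ↔ a ∈ N.elems P ∧ N.lt P a e := by
  classical
  simp [before]

lemma before_subset (P : Path) (e : E) : N.before P e ⊆ N.elems P :=
  fun _ h => (N.mem_before.1 h).1

lemma before_ssubset_before {P : Path} {a b : E} (ha : a ∈ N.elems P) (hb : b ∈ N.elems P)
    (h : N.lt P a b) : N.before P a ⊂ N.before P b := by
  refine (Finset.ssubset_iff_of_subset fun d hd => ?_).2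
    ⟨a, N.mem_before.2 ⟨ha, h⟩, fun h' => ?_⟩
  · rw [mem_before] at hd ⊢
    exact ⟨hd.1, N.lt_trans P d hd.1 a ha b hb hd.2 h⟩
  · exact N.lt_irrefl P a ha (N.mem_before.1 h').2

lemma card_before_lt {P : Path} {a b : E} (ha : a ∈ N.elems P) (hb : b ∈ N.elems P)
    (h : N.lt P a b) : (N.before P a).card < (N.before P b).card :=
  Finset.card_lt_card (N.before_ssubset_before ha hb h)

lemma exists_first {P : Path} {A : Finset E} (hA : A ⊆ N.elems P) (hne : A.Nonempty) :
    ∃ m ∈ A, ∀ a ∈ A, ¬ N.lt P a m := by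
  obtain ⟨m, hm, h⟩ := A.exists_min_image (fun a => (N.before P a).card) hne
  exact ⟨m, hm, fun a ha hlt => (h a ha).not_gt (N.card_before_lt (hA ha) (hA hm) hlt)⟩

lemma exists_last {P : Path} {A : Finset E} (hA : A ⊆ N.elems P) (hne : A.Nonempty) :
    ∃ m ∈ A, ∀ a ∈ A, ¬ N.lt P m a := by
  obtain ⟨m, hm, h⟩ := A.exists_max_image (fun a => (N.before P a).card) hne
  exact ⟨m, hm, fun a ha hlt => (h a ha).not_gt (N.card_before_lt (hA hm) (hA ha) hlt)⟩

lemma before_add_self_le {P : Path} {e : E} (he : e ∈ N.elems P) {A : Finset E}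
    (hA : N.before P e ⊆ A) (heA : e ∈ A) {f : E → ℝ} (hf : ∀ a, 0 ≤ f a) :
    ∑ a ∈ N.before P e, f a + f e ≤ ∑ a ∈ A, f a := by
  classical
  have hn : e ∉ N.before P e := fun h => N.lt_irrefl P e he (N.mem_before.1 h).2
  rw [add_comm, ← Finset.sum_insert hn]
  exact Finset.sum_le_sum_of_subset_of_nonneg (Finset.insert_subset heA hA) fun a _ _ => hf a

lemma le_before_add_self {Q : Path} {e : E} (he : e ∈ N.elems Q) {A : Finset E}
    (hA : ∀ a ∈ A, a ∈ N.elems Q ∧ (N.lt Q a e ∨ a = e)) {f : E → ℝ} (hf : ∀ a, 0 ≤ f a) :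
    ∑ a ∈ A, f a ≤ ∑ a ∈ N.before Q e, f a + f e := by
  classical
  have hn : e ∉ N.before Q e := fun h => N.lt_irrefl Q e he (N.mem_before.1 h).2
  rw [add_comm, ← Finset.sum_insert hn]
  refine Finset.sum_le_sum_of_subset_of_nonneg (fun a ha => ?_) fun a _ _ => hf a
  rw [Finset.mem_insert, mem_before]
  have := hA a ha
  tauto

/-- `α e` is the least length, with respect to `w`, of the part before `e` of a path through
`e`. -/
def IsEntry (w α : E → ℝ) : Prop :=
  (∀ P, ∀ e ∈ N.elems P, α e ≤ ∑ p ∈ N.before P e, w p) ∧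
    ∀ P, ∀ e ∈ N.elems P, ∃ Q, e ∈ N.elems Q ∧ α e = ∑ p ∈ N.before Q e, w p

lemma exists_isEntry [Finite Path] (w : E → ℝ) : ∃ α, N.IsEntry w α := by
  classical
  have := Fintype.ofFinite Path
  have key : ∀ e, ∃ a : ℝ, (∀ P, e ∈ N.elems P → a ≤ ∑ p ∈ N.before P e, w p) ∧
      ∀ P, e ∈ N.elems P → ∃ Q, e ∈ N.elems Q ∧ a = ∑ p ∈ N.before Q e, w p := by
    intro e
    by_cases h : ∃ P, e ∈ N.elems P
    · obtain ⟨P₀, hP₀⟩ := h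
      obtain ⟨Q, hQ, hmin⟩ := Finset.exists_min_image
        (Finset.univ.filter fun P => e ∈ N.elems P) (fun P => ∑ p ∈ N.before P e, w p)
        ⟨P₀, by simpa using hP₀⟩
      simp only [Finset.mem_filter, Finset.mem_univ, true_and] at hQ hmin
      exact ⟨_, hmin, fun _ _ => ⟨Q, hQ, rfl⟩⟩
    · exact ⟨0, fun P hP => (h ⟨P, hP⟩).elim, fun P hP => (h ⟨P, hP⟩).elim⟩
  choose α h₁ h₂ using key
  exact ⟨α, fun P e => h₁ e P, fun P e => h₂ e P⟩

/-- If every path has length at least `T` with respect to `τ + y`, then the path `P`, started at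
a real time `s ≥ 0` so that it arrives before `T`, passes some element `e` during
`[α e, α e + y e)`. -/
lemma exists_mem_entry_le_lt (hN : ∀ P, (N.elems P).Nonempty) {τ y α : E → ℝ} {T : ℝ}
    (hτ : ∀ e, 0 ≤ τ e) (hy : ∀ e, 0 ≤ y e) (hα : N.IsEntry (fun e => τ e + y e) α)
    (hT : ∀ P, T ≤ ∑ e ∈ N.elems P, (τ e + y e)) {P : Path} {s : ℝ} (hs : 0 ≤ s)
    (hsT : s + ∑ e ∈ N.elems P, τ e < T) :
    ∃ e ∈ N.elems P, α e ≤ s + ∑ a ∈ N.before P e, τ a ∧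
      s + ∑ a ∈ N.before P e, τ a < α e + y e := by
  classical
  by_contra! hcon
  have hw : ∀ e, 0 ≤ τ e + y e := fun e => add_nonneg (hτ e) (hy e)
  -- The elements whose window is already over when `P` arrives. By `hcon`, having reached `α e` on
  -- arrival at `e` is enough to belong to `G`.
  set G := (N.elems P).filter fun e => α e + y e ≤ s + ∑ a ∈ N.before P e, τ a with hG
  have hGne : G.Nonempty := by
    obtain ⟨m, hm, hfirst⟩ := N.exists_first (Finset.Subset.refl (N.elems P)) (hN P)
    have hb : N.before P m = ∅ := Finset.eq_empty_of_forall_notMem fun a ha =>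
      hfirst a (N.mem_before.1 ha).1 (N.mem_before.1 ha).2
    have h0 : α m ≤ 0 := by simpa [hb] using hα.1 P m hm
    refine ⟨m, Finset.mem_filter.2 ⟨hm, hcon m hm ?_⟩⟩
    rw [hb, Finset.sum_empty]
    linarith
  obtain ⟨i, hiG, hlast⟩ := N.exists_last (Finset.filter_subset _ _) hGne
  obtain ⟨hiP, hi⟩ := Finset.mem_filter.1 hiG
  obtain ⟨Q, hiQ, hαQ⟩ := hα.2 P i hiP
  obtain ⟨R, hR⟩ := N.switching Q P i hiQ hiP
  by_cases hB : ((N.elems R).filter fun a => a ∈ N.elems P ∧ N.lt P i a).Nonempty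
  -- First in the order of `R`, which need not agree with that of `P`: then all that precedes `j` on
  -- `R` lies on `Q` up to `i`. Hence `α j ≤ α i + τ i + y i`, which is at most the arrival of `P`
  -- at `i` plus `τ i`, so `j` belongs to `G`.
  · obtain ⟨j, hj, hjfirst⟩ := N.exists_first (Finset.filter_subset _ _) hB
    obtain ⟨hjR, hjP, hij⟩ := Finset.mem_filter.1 hj
    have h1 := hα.1 R j hjR
    have h2 : ∑ p ∈ N.before R j, (τ p + y p) ≤ _ :=
      N.le_before_add_self hiQ (f := fun e => τ e + y e) (fun a ha => by
        rw [mem_before] at ha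
        rcases hR a ha.1 with h | ⟨haP, rfl | h⟩
        · exact h
        · exact ⟨hiQ, Or.inr rfl⟩
        · exact (hjfirst a (Finset.mem_filter.2 ⟨ha.1, haP, h⟩) ha.2).elim) hw
    have h3 := N.before_add_self_le hiP (N.before_ssubset_before hiP hjP hij).subset
      (N.mem_before.2 ⟨hiP, hij⟩) hτ
    exact hlast j (Finset.mem_filter.2 ⟨hjP, hcon j hjP (by linarith)⟩) hij
  -- Now `R` lies entirely on `Q` up to `i`, so its length is at most `α i + τ i + y i`, hence at
  -- most the arrival time of `P` at its end, which is below `T`.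
  · have h2 : ∑ p ∈ N.elems R, (τ p + y p) ≤ _ :=
      N.le_before_add_self hiQ (f := fun e => τ e + y e) (fun a ha => by
        rcases hR a ha with h | ⟨haP, rfl | h⟩
        · exact h
        · exact ⟨hiQ, Or.inr rfl⟩
        · exact (hB ⟨a, Finset.mem_filter.2 ⟨ha, haP, h⟩⟩).elim) hw
    have h3 := N.before_add_self_le hiP (N.before_subset P i) hiP hτ
    linarith [hT R]

/-- Both `R ∪ S ⊆ P ∪ Q` and `R ∩ S ⊆ P ∩ Q` hold, and transit times are nonnegative. -/
lemma isSupermodular_weight (τ : E → ℕ) (T : ℕ) : N.IsSupermodular (N.weight τ T) := by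
  classical
  intro P Q e heP heQ R S hR hS
  have key : ∑ a ∈ N.elems R, (τ a : ℝ) + ∑ a ∈ N.elems S, (τ a : ℝ) ≤
      ∑ a ∈ N.elems P, (τ a : ℝ) + ∑ a ∈ N.elems Q, (τ a : ℝ) := by
    rw [← Finset.sum_union_inter, ← Finset.sum_union_inter (s₁ := N.elems P)]
    refine add_le_add (Finset.sum_le_sum_of_subset_of_nonneg (fun a ha => ?_) (by simp))
      (Finset.sum_le_sum_of_subset_of_nonneg (fun a ha => ?_) (by simp))
    · rcases Finset.mem_union.1 ha with h | h
      · rcases hR a h with h | h <;> simp [h.1]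
      · rcases hS a h with h | h <;> simp [h.1]
    · rw [Finset.mem_inter] at ha ⊢
      have asymm : ∀ P', a ∈ N.elems P' → e ∈ N.elems P' → N.lt P' a e → ¬ N.lt P' e a :=
        fun P' h h' h1 h2 => N.lt_irrefl P' a h (N.lt_trans P' a h e h' a h h1 h2)
      have hP := asymm P
      have hQ := asymm Q
      have h1 := hR a ha.1
      have h2 := hS a ha.2
      by_cases hae : a = e
      · subst hae
        exact ⟨heP, heQ⟩
      · tauto
  simp only [weight]
  linarith

end Order

/-! ### Strong duality for the static problem -/

section StrongDuality

variable [Fintype Path] (N : AbstractNetwork E Path)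

/-- The pairs `(u, s)` such that some nonnegative `x` respects the capacities `u` and has value
at least `s`. -/
def valueCone (r : Path → ℝ) : Set ((E → ℝ) × ℝ) :=
  {q | ∃ x, N.IsFlow q.1 x ∧ q.2 ≤ ∑ P, r P * x P}

variable {N}

lemma IsFlow.le {c : E → ℝ} {x : Path → ℝ} (hx : N.IsFlow c x) {P : Path} {e : E}
    (he : e ∈ N.elems P) : x P ≤ c e := by
  classical
  refine le_trans ?_ (hx.2 e)
  exact Finset.single_le_sum (f := x) (fun Q _ => hx.1 Q) (by simpa using he)

lemma isClosed_setOf_isFlow_le (r : Path → ℝ) :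
    IsClosed {q : ((E → ℝ) × ℝ) × (Path → ℝ) |
      N.IsFlow q.1.1 q.2 ∧ q.1.2 ≤ ∑ P, r P * q.2 P} := by
  simp only [IsFlow, Set.ofPred_and, Set.ofPred_forall]
  refine ((isClosed_iInter fun P => ?_).inter (isClosed_iInter fun e => ?_)).inter ?_ <;>
  exact isClosed_le (by fun_prop) (by fun_prop)

/-- Since paths are nonempty, capacities bound the flow on each path, so witnesses for a convergent
sequence have a convergent subsequence. -/
lemma isClosed_valueCone [Fintype E] (hN : ∀ P, (N.elems P).Nonempty) (r : Path → ℝ) :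
    IsClosed (N.valueCone r) := by
  refine IsSeqClosed.isClosed fun q q₀ hq hlim => ?_
  choose x hx using hq
  obtain ⟨B, hB⟩ := (Metric.isBounded_range_of_tendsto q hlim).exists_norm_le
  have hmem : ∀ n, x n ∈ Metric.closedBall (0 : Path → ℝ) B := by
    intro n
    have hn : ‖q n‖ ≤ B := hB _ ⟨n, rfl⟩
    rw [mem_closedBall_zero_iff, pi_norm_le_iff_of_nonneg ((norm_nonneg _).trans hn)]
    intro P
    obtain ⟨e, he⟩ := hN P
    rw [Real.norm_of_nonneg ((hx n).1.1 P)]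
    calc x n P ≤ (q n).1 e := (hx n).1.le he
      _ ≤ ‖(q n).1 e‖ := Real.le_norm_self _
      _ ≤ ‖(q n).1‖ := norm_le_pi_norm _ e
      _ ≤ ‖q n‖ := norm_fst_le _
      _ ≤ B := hn
  obtain ⟨x₀, -, φ, hφ, hx₀⟩ := (isCompact_closedBall (0 : Path → ℝ) B).tendsto_subseq hmem
  exact ⟨x₀, (isClosed_setOf_isFlow_le r).mem_of_tendsto
    ((hlim.comp hφ.tendsto_atTop).prodMk_nhds hx₀) (Filter.Eventually.of_forall fun n => hx (φ n))⟩

lemma valueCone_add {r : Path → ℝ} {q q' : (E → ℝ) × ℝ} (hq : q ∈ N.valueCone r)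
    (hq' : q' ∈ N.valueCone r) : q + q' ∈ N.valueCone r := by
  classical
  obtain ⟨x, hx, hv⟩ := hq
  obtain ⟨x', hx', hv'⟩ := hq'
  refine ⟨x + x', ⟨fun P => add_nonneg (hx.1 P) (hx'.1 P), fun e => ?_⟩, ?_⟩
  · simpa [Finset.sum_add_distrib] using add_le_add (hx.2 e) (hx'.2 e)
  · simpa [mul_add, Finset.sum_add_distrib] using add_le_add hv hv'

lemma valueCone_smul {r : Path → ℝ} {q : (E → ℝ) × ℝ} (hq : q ∈ N.valueCone r) {k : ℝ}
    (hk : 0 ≤ k) : k • q ∈ N.valueCone r := by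
  classical
  obtain ⟨x, hx, hv⟩ := hq
  refine ⟨k • x, ⟨fun P => mul_nonneg hk (hx.1 P), fun e => ?_⟩, ?_⟩
  · simpa [Finset.mul_sum] using mul_le_mul_of_nonneg_left (hx.2 e) hk
  · simpa [Finset.mul_sum, mul_left_comm] using mul_le_mul_of_nonneg_left hv hk

lemma convex_valueCone (r : Path → ℝ) : Convex ℝ (N.valueCone r) :=
  fun _ hq _ hq' _ _ ha hb _ => valueCone_add (valueCone_smul hq ha) (valueCone_smul hq' hb)

lemma zero_mem_valueCone (r : Path → ℝ) : (0 : (E → ℝ) × ℝ) ∈ N.valueCone r :=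
  ⟨0, ⟨fun _ => le_rfl, by simp⟩, by simp⟩

/-- A value `s` that no flow attains is beaten by a weighted cut. -/
lemma exists_isWeightedCut_lt [Fintype E] (hN : ∀ P, (N.elems P).Nonempty) {c : E → ℝ}
    (hc : ∀ e, 0 ≤ c e)
    {r : Path → ℝ} {s : ℝ} (hs : (c, s) ∉ N.valueCone r) :
    ∃ y, N.IsWeightedCut r y ∧ ∑ e, c e * y e < s := by
  classical
  obtain ⟨f, β, hf, hβ⟩ := geometric_hahn_banach_closed_point (convex_valueCone r)
    (isClosed_valueCone hN r) hs
  have hβ0 : 0 < β := by simpa using hf 0 (zero_mem_valueCone r)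
  -- A functional bounded above on a cone is nonpositive there: scaling `q` by `β / f q` would
  -- attain the excluded value `β`.
  have hnonpos : ∀ q ∈ N.valueCone r, f q ≤ 0 := by
    intro q hq
    by_contra! hpos
    have := hf _ (valueCone_smul hq (div_pos hβ0 hpos).le)
    rw [map_smul, smul_eq_mul, div_mul_cancel₀ _ hpos.ne'] at this
    exact this.false
  -- The separating functional is a price `z` for value and prices `g` for capacity; the cut sought
  -- is `g / z`.
  set z := f (0, 1) with hz
  set g : E → ℝ := fun e => -f (Pi.single e 1, 0) with hg
  have hfexp : ∀ u t, f (u, t) = -∑ e, u e * g e + t * z := by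
    intro u t
    have : (u, t) = ∑ e, u e • ((Pi.single e 1, 0) : (E → ℝ) × ℝ) + t • ((0, 1) : (E → ℝ) × ℝ) := by
      ext e
      · simp [Prod.fst_sum, Finset.sum_apply, Pi.single_apply]
      · simp [Prod.snd_sum]
    rw [this, map_add, map_sum, map_smul]
    simp only [map_smul, smul_eq_mul, hg, hz, mul_neg, Finset.sum_neg_distrib, neg_neg]
  have hg0 : ∀ e, 0 ≤ g e := by
    intro e
    rw [hg, neg_nonneg]
    refine hnonpos _ ⟨0, ⟨fun _ => le_rfl, fun e' => ?_⟩, by simp⟩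
    by_cases h : e' = e
    · subst h; simp
    · simp [h]
  have hz0 : 0 ≤ z := by
    have := hnonpos (0, -1) ⟨0, ⟨fun _ => le_rfl, by simp⟩, by simp⟩
    rw [hfexp] at this
    simpa using this
  have hrP : ∀ P, r P * z ≤ ∑ e ∈ N.elems P, g e := by
    intro P
    -- One unit of flow along `P` needs exactly the indicator of `P` as capacity.
    have := hnonpos (fun e => if e ∈ N.elems P then 1 else 0, r P)
      ⟨Pi.single P 1, ⟨fun Q => ?_, fun e => ?_⟩, by simp [Pi.single_apply]⟩
    · rw [hfexp] at this
      simpa [ite_mul] using this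
    · by_cases h : Q = P
      · subst h; simp
      · simp [h]
    · simp [Pi.single_apply]
  have hcs : ∑ e, c e * g e < s * z := by
    rw [hfexp] at hβ
    linarith
  have hcg : 0 ≤ ∑ e, c e * g e := Finset.sum_nonneg fun e _ => mul_nonneg (hc e) (hg0 e)
  have hzpos : 0 < z := hz0.lt_of_ne fun h => by
    rw [← h, mul_zero] at hcs
    linarith
  refine ⟨fun e => g e / z, ⟨fun e => div_nonneg (hg0 e) hz0, fun P => ?_⟩, ?_⟩
  · rw [← Finset.sum_div, le_div_iff₀ hzpos]
    exact hrP P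
  · simp_rw [← mul_div_assoc]
    rwa [← Finset.sum_div, div_lt_iff₀ hzpos]

lemma IsFlow.value_le [Fintype E] {c : E → ℝ} {r : Path → ℝ} {x : Path → ℝ} {y : E → ℝ}
    (hx : N.IsFlow c x) (hy : N.IsWeightedCut r y) : ∑ P, r P * x P ≤ ∑ e, c e * y e := by
  classical
  calc ∑ P, r P * x P ≤ ∑ P, (∑ e ∈ N.elems P, y e) * x P :=
        Finset.sum_le_sum fun P _ => mul_le_mul_of_nonneg_right (hy.2 P) (hx.1 P)
    _ = ∑ e, (∑ P with e ∈ N.elems P, x P) * y e := by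
        simp_rw [Finset.sum_mul, Finset.sum_filter]
        rw [Finset.sum_comm]
        refine Finset.sum_congr rfl fun P _ => ?_
        rw [← Finset.sum_filter]
        refine Finset.sum_congr (by ext; simp) fun e _ => mul_comm _ _
    _ ≤ ∑ e, c e * y e :=
        Finset.sum_le_sum fun e _ => mul_le_mul_of_nonneg_right (hx.2 e) (hy.1 e)

lemma IsMinWeightedCut.exists_isFlow [Fintype E] (hN : ∀ P, (N.elems P).Nonempty) {c : E → ℝ}
    (hc : ∀ e, 0 ≤ c e) {r : Path → ℝ} {y : E → ℝ} (hy : N.IsMinWeightedCut c r y) :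
    ∃ x, N.IsFlow c x ∧ ∑ P, r P * x P = ∑ e, c e * y e := by
  by_cases h : (c, ∑ e, c e * y e) ∈ N.valueCone r
  · obtain ⟨x, hx, hv⟩ := h
    exact ⟨x, hx, le_antisymm (hx.value_le hy.1) hv⟩
  · obtain ⟨y', hy', hlt⟩ := exists_isWeightedCut_lt hN hc h
    exact absurd (hy.2 y' hy') hlt.not_ge

end StrongDuality

/-! ### Integrality of the dual by averaging over shifted lattices -/

section Rounding

variable (N : AbstractNetwork E Path)

/-- The number of integers `j` in `[n a, n b)` with remainder `k` modulo `n`; equivalently, of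
integers `i` with `a ≤ i + k / n < b`. -/
noncomputable def latticeCount (n k : ℕ) (a b : ℝ) : ℕ :=
  ((Finset.Ico ⌈n * a⌉ ⌈n * b⌉).filter fun j => j % (n : ℤ) = k).card

/-- The residue classes modulo `n` partition the integers in `[n a, n b)`. -/
lemma sum_latticeCount_le {n : ℕ} (hn : 0 < n) {a b : ℝ} (hab : a ≤ b) :
    (∑ k ∈ Finset.range n, (latticeCount n k a b : ℝ)) ≤ n * (b - a) + 1 := by
  have hn' : (0 : ℤ) < n := by exact_mod_cast hn
  have h : (Finset.Ico ⌈n * a⌉ ⌈n * b⌉).card = ∑ k ∈ Finset.range n, latticeCount n k a b := by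
    rw [Finset.card_eq_sum_card_fiberwise (f := fun j : ℤ => (j % (n : ℤ)).toNat)
      (t := Finset.range n)]
    · refine Finset.sum_congr rfl fun k _ => ?_
      unfold latticeCount
      congr 1
      refine Finset.filter_congr fun j _ => ?_
      have := Int.emod_nonneg j hn'.ne'
      omega
    · intro j _
      have := Int.emod_nonneg j hn'.ne'
      have := Int.emod_lt_of_pos j hn'
      simp only [Finset.coe_range, Set.mem_Iio]
      omega
  have hle : ⌈n * a⌉ ≤ ⌈n * b⌉ := Int.ceil_le_ceil (by gcongr)
  rw [← Nat.cast_sum, ← h, Int.card_Ico, ← Int.cast_natCast, Int.toNat_of_nonneg (by omega)]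
  push_cast
  have := Int.le_ceil (n * a)
  have := Int.ceil_lt_add_one (n * b)
  linarith

/-- The number of `t` for which `t + k / n + d` lies in `[a, b)`. -/
lemma card_filter_le_latticeCount {n k : ℕ} (hk : k < n) (m d : ℕ) (a b : ℝ) :
    ((Finset.range m).filter fun t : ℕ =>
      a ≤ (t : ℝ) + k / n + d ∧ (t : ℝ) + k / n + d < b).card ≤ latticeCount n k a b := by
  have hn : 0 < n := by omega
  have hnR : (0 : ℝ) < n := by exact_mod_cast hn
  refine Finset.card_le_card_of_injOn (fun t => (n : ℤ) * (t + d) + k) (fun t ht => ?_) ?_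
  · simp only [Finset.coe_filter, Set.mem_ofPred_eq, Finset.mem_Ico, Finset.mem_range] at ht ⊢
    have e : (((n : ℤ) * (t + d) + k : ℤ) : ℝ) = n * ((t : ℝ) + k / n + d) := by
      push_cast
      field_simp
      ring
    refine ⟨⟨Int.ceil_le.2 ?_, Int.lt_ceil.2 ?_⟩, ?_⟩
    · rw [e]
      exact mul_le_mul_of_nonneg_left ht.2.1 hnR.le
    · rw [e]
      exact mul_lt_mul_of_pos_left ht.2.2 hnR
    · rw [Int.mul_add_emod_self_left]
      exact Int.emod_eq_of_lt (by omega) (by omega)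
  · intro t _ t' _ h
    have hn0 : (n : ℤ) ≠ 0 := by omega
    have := mul_left_cancel₀ hn0 (add_right_cancel h)
    omega

variable {N}

/-- Each start `t + k/n` with `t < r(P)` hits the window of some `e ∈ P`, and the starts that hit
the window of `e` number at most the lattice points in it. -/
lemma isWeightedCut_latticeCount (hN : ∀ P, (N.elems P).Nonempty) {τ : E → ℕ} {T : ℕ}
    {y α : E → ℝ} (hy : N.IsWeightedCut (N.weight τ T) y)
    (hα : N.IsEntry (fun e => (τ e : ℝ) + y e) α) {n k : ℕ} (hk : k < n) :
    N.IsWeightedCut (N.weight τ T) fun e => (latticeCount n k (α e) (α e + y e) : ℝ) := by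
  classical
  refine ⟨fun e => Nat.cast_nonneg _, fun P => ?_⟩
  have hcover : Finset.range (T - ∑ e ∈ N.elems P, τ e) ⊆ (N.elems P).biUnion fun e =>
      (Finset.range (T - ∑ e ∈ N.elems P, τ e)).filter fun t : ℕ =>
        α e ≤ (t : ℝ) + k / n + (∑ a ∈ N.before P e, τ a : ℕ) ∧
          (t : ℝ) + k / n + (∑ a ∈ N.before P e, τ a : ℕ) < α e + y e := by
    intro t ht
    have ht' : t + 1 + ∑ e ∈ N.elems P, τ e ≤ T := by
      have := Finset.mem_range.1 ht
      omega
    have htR : (t : ℝ) + 1 + ∑ e ∈ N.elems P, (τ e : ℝ) ≤ T := by exact_mod_cast ht'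
    -- The shift is less than one time unit, so the shifted start still arrives strictly before `T`.
    have hkn : (k : ℝ) / n < 1 := (div_lt_one (by exact_mod_cast (by omega : 0 < n))).2
      (by exact_mod_cast hk)
    obtain ⟨e, he, h1, h2⟩ := N.exists_mem_entry_le_lt hN (T := T) (P := P) (s := t + k / n)
      (fun e => Nat.cast_nonneg (τ e)) hy.1 hα (fun Q => by
        rw [Finset.sum_add_distrib]
        have := hy.2 Q
        simp only [weight] at this
        linarith) (by positivity) (by linarith)
    refine Finset.mem_biUnion.2 ⟨e, he, Finset.mem_filter.2 ⟨ht, ?_⟩⟩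
    push_cast
    exact ⟨h1, h2⟩
  have hcard := (Finset.card_le_card hcover).trans (Finset.card_biUnion_le.trans
    (Finset.sum_le_sum fun e _ => card_filter_le_latticeCount hk _ _ _ _))
  rw [Finset.card_range, Nat.sub_le_iff_le_add] at hcard
  have : (T : ℝ) ≤ _ := Nat.cast_le.2 hcard
  push_cast at this
  simp only [weight]
  linarith

lemma le_of_forall_nat_isWeightedCut [Fintype E] [Finite Path] (hN : ∀ P, (N.elems P).Nonempty)
    {c : E → ℝ} (hc : ∀ e, 0 ≤ c e) {τ : E → ℕ} {T : ℕ} {M : ℝ}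
    (hM : ∀ y : E → ℕ, N.IsWeightedCut (N.weight τ T) (fun e => (y e : ℝ)) →
      M ≤ ∑ e, c e * (y e : ℝ)) {y : E → ℝ} (hy : N.IsWeightedCut (N.weight τ T) y) :
    M ≤ ∑ e, c e * y e := by
  obtain ⟨α, hα⟩ := N.exists_isEntry fun e => (τ e : ℝ) + y e
  -- Summing the bound `M` over the `n` rounded solutions leaves an error independent of `n`.
  have key : ∀ n : ℕ, 0 < n → n * (M - ∑ e, c e * y e) ≤ ∑ e, c e := by
    intro n hn
    have h1 : n * M ≤
        ∑ k ∈ Finset.range n, ∑ e, c e * (latticeCount n k (α e) (α e + y e) : ℝ) := by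
      have := Finset.card_nsmul_le_sum (Finset.range n) _ M fun k hk =>
        hM _ (isWeightedCut_latticeCount hN hy hα (Finset.mem_range.1 hk))
      simpa using this
    rw [Finset.sum_comm] at h1
    have h2 : ∀ e, ∑ k ∈ Finset.range n, c e * (latticeCount n k (α e) (α e + y e) : ℝ) ≤
        n * (c e * y e) + c e := by
      intro e
      have := mul_le_mul_of_nonneg_left
        (sum_latticeCount_le hn (le_add_of_nonneg_right (hy.1 e) : α e ≤ α e + y e)) (hc e)
      rw [← Finset.mul_sum]
      linarith
    have h3 := h1.trans (Finset.sum_le_sum fun e _ => h2 e)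
    rw [Finset.sum_add_distrib, ← Finset.mul_sum] at h3
    linarith
  by_contra! hlt
  obtain ⟨n, hn⟩ := exists_nat_gt ((∑ e, c e) / (M - ∑ e, c e * y e))
  rw [div_lt_iff₀ (sub_pos.2 hlt)] at hn
  rcases Nat.eq_zero_or_pos n with rfl | hpos
  · have := Finset.sum_nonneg fun e (_ : e ∈ Finset.univ) => hc e
    simp at hn
    linarith
  · exact (key n hpos).not_gt hn

lemma weight_le (τ : E → ℕ) (T : ℕ) (P : Path) : N.weight τ T P ≤ T :=
  sub_le_self _ (Finset.sum_nonneg fun _ _ => Nat.cast_nonneg _)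

/-- A value cut down to `T` covers its paths alone, as weights are at most `T`. Minimising over
integral cuts thus becomes a finite problem. -/
lemma isWeightedCut_min {τ : E → ℕ} {T : ℕ} {y : E → ℕ}
    (hy : N.IsWeightedCut (N.weight τ T) fun e => (y e : ℝ)) :
    N.IsWeightedCut (N.weight τ T) fun e => ((min (y e) T : ℕ) : ℝ) := by
  refine ⟨fun e => Nat.cast_nonneg _, fun P => ?_⟩
  by_cases h : ∃ e ∈ N.elems P, T ≤ y e
  · obtain ⟨e, he, hT⟩ := h
    refine (weight_le τ T P).trans ?_
    have := Finset.single_le_sum (f := fun e => ((min (y e) T : ℕ) : ℝ))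
      (fun a _ => Nat.cast_nonneg _) he
    simpa [min_eq_right hT] using this
  · push Not at h
    refine (hy.2 P).trans_eq (Finset.sum_congr rfl fun e he => ?_)
    simp only [min_eq_left (h e he).le]

theorem exists_nat_isMinWeightedCut [Fintype E] [Finite Path] (hN : ∀ P, (N.elems P).Nonempty)
    {c : E → ℝ} (hc : ∀ e, 0 ≤ c e) (τ : E → ℕ) (T : ℕ) :
    ∃ y : E → ℕ, N.IsMinWeightedCut c (N.weight τ T) (fun e => (y e : ℝ)) := by
  classical
  have hfin : ({y : E → ℕ | y ≤ (fun _ => T) ∧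
      N.IsWeightedCut (N.weight τ T) fun e => (y e : ℝ)}).Finite :=
    (Set.finite_Iic (fun _ : E => T)).subset fun y hy => hy.1
  obtain ⟨y, ⟨-, hy⟩, hmin⟩ := Set.exists_min_image _ (fun y : E → ℕ => ∑ e, c e * (y e : ℝ)) hfin
    ⟨fun _ => T, le_rfl, fun _ => Nat.cast_nonneg _, fun P => (weight_le τ T P).trans (by
      have : (1 : ℝ) ≤ (N.elems P).card := by exact_mod_cast (hN P).card_pos
      simpa using le_mul_of_one_le_left (Nat.cast_nonneg T) this)⟩
  refine ⟨y, hy, fun y' hy' => le_of_forall_nat_isWeightedCut hN hc (fun z hz => ?_) hy'⟩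
  refine (hmin (fun e => min (z e) T) ⟨fun e => min_le_right _ _, isWeightedCut_min hz⟩).trans ?_
  exact Finset.sum_le_sum fun e _ => mul_le_mul_of_nonneg_left
    (Nat.cast_le.2 (min_le_left _ _)) (hc e)

end Rounding

/-! ### Flows and cuts over time -/

section OverTime

variable {N : AbstractNetwork E Path} {τ : E → ℕ} {T : ℕ}

lemma isEntry_entryTime (y : E → ℕ) :
    N.IsEntry (fun e => (τ e : ℝ) + y e) fun e => (N.entryTime τ y e : ℝ) := by
  refine ⟨fun P e he => ?_, fun P e he => ?_⟩
  · have h : N.entryTime τ y e ≤ ∑ p ∈ N.before P e, (τ p + y p) := Nat.sInf_le ⟨P, he, rfl⟩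
    simpa using Nat.cast_le (α := ℝ).2 h
  · obtain ⟨Q, hQ, h⟩ := Nat.sInf_mem (⟨_, P, he, rfl⟩ :
      {n | ∃ P, e ∈ N.elems P ∧ n = ∑ p ∈ N.before P e, (τ p + y p)}.Nonempty)
    refine ⟨Q, hQ, ?_⟩
    simpa [entryTime] using congrArg (Nat.cast (R := ℝ)) h

lemma isCutOverTime_cutOverTime [Fintype E] (hN : ∀ P, (N.elems P).Nonempty) {y : E → ℕ}
    (hy : N.IsWeightedCut (N.weight τ T) fun e => (y e : ℝ)) :
    N.IsCutOverTime τ T (N.cutOverTime τ T y) := by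
  classical
  rintro ⟨⟨P, t⟩, hp⟩
  obtain ⟨e, he, h1, h2⟩ := N.exists_mem_entry_le_lt hN (T := T) (P := P) (s := (t : ℕ))
    (fun e => Nat.cast_nonneg (τ e)) hy.1 (isEntry_entryTime y) (fun Q => by
      rw [Finset.sum_add_distrib]
      have := hy.2 Q
      simp only [weight] at this
      linarith) (Nat.cast_nonneg _) (by exact_mod_cast hp)
  have hlt : (t : ℕ) + ∑ a ∈ N.before P e, τ a < T :=
    lt_of_le_of_lt (Nat.add_le_add_left
      (Finset.sum_le_sum_of_subset (N.before_subset P e)) _) hp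
  refine ⟨(e, ⟨_, hlt⟩), ?_, he, rfl⟩
  simp only [cutOverTime, Finset.mem_filter, Finset.mem_univ, true_and]
  exact ⟨by exact_mod_cast h1, by exact_mod_cast h2⟩

/-- Only an inequality at this stage, since a window may extend beyond the horizon. -/
lemma sum_cutOverTime_le [Fintype E] {c : E → ℝ} (hc : ∀ e, 0 ≤ c e) (y : E → ℕ) :
    ∑ z ∈ N.cutOverTime τ T y, c z.1 ≤ ∑ e, c e * (y e : ℝ) := by
  classical
  rw [cutOverTime, Finset.sum_filter, Fintype.sum_prod_type]
  refine Finset.sum_le_sum fun e _ => ?_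
  dsimp only
  rw [← Finset.sum_filter, Finset.sum_const, nsmul_eq_mul, mul_comm]
  refine mul_le_mul_of_nonneg_left (Nat.cast_le.2 ?_) (hc e)
  calc _ ≤ (Finset.Ico (N.entryTime τ y e) (N.entryTime τ y e + y e)).card :=
        Finset.card_le_card_of_injOn (fun θ : Fin T => (θ : ℕ))
          (fun θ hθ => by simpa using hθ) (fun θ _ θ' _ h => Fin.ext h)
    _ = y e := by simp

lemma IsFlowOverTime.value_le [Fintype Path] {c : E → ℝ} {x : N.TemporalPath τ T → ℝ}
    (hx : N.IsFlowOverTime c τ T x) {C : Finset (E × Fin T)} (hC : N.IsCutOverTime τ T C) :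
    ∑ p, x p ≤ ∑ z ∈ C, c z.1 := by
  classical
  calc ∑ p, x p ≤ ∑ p, ∑ z ∈ C, if z ∈ N.temporalElems p then x p else 0 := by
        refine Finset.sum_le_sum fun p _ => ?_
        obtain ⟨z, hz, hzp⟩ := hC p
        have := Finset.single_le_sum (f := fun z => if z ∈ N.temporalElems p then x p else 0)
          (fun z _ => by split_ifs <;> simp [hx.1 p]) hz
        simpa [hzp] using this
    _ = ∑ z ∈ C, ∑ p with z ∈ N.temporalElems p, x p := by
        rw [Finset.sum_comm]
        simp_rw [Finset.sum_filter]
    _ ≤ ∑ z ∈ C, c z.1 := Finset.sum_le_sum fun z _ => by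
        convert hx.2 z.1 z.2

lemma isFlowOverTime_temporallyRepeated [Fintype Path] {c : E → ℝ} {x : Path → ℝ}
    (hx : N.IsFlow c x) : N.IsFlowOverTime c τ T (N.temporallyRepeated τ T x) := by
  classical
  refine ⟨fun p => hx.1 _, fun e θ => le_trans ?_ (hx.2 e)⟩
  -- A path that passes `e` at time `θ` has its starting time determined.
  have hinj : Set.InjOn (fun p : N.TemporalPath τ T => p.1.1)
      (Finset.univ.filter fun p : N.TemporalPath τ T => (e, θ) ∈ N.temporalElems p) := by
    rintro ⟨⟨P, t⟩, hp⟩ h ⟨⟨P', t'⟩, hp'⟩ h' (rfl : P = P')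
    have h₁ : (θ : ℕ) = t + ∑ a ∈ N.before P e, τ a := (Finset.mem_filter.1 h).2.2
    have h₂ : (θ : ℕ) = t' + ∑ a ∈ N.before P e, τ a := (Finset.mem_filter.1 h').2.2
    have : t = t' := Fin.ext (by omega)
    subst this
    rfl
  calc _ = ∑ P ∈ (Finset.univ.filter fun p : N.TemporalPath τ T =>
          (e, θ) ∈ N.temporalElems p).image (fun p => p.1.1), x P := by
        rw [Finset.sum_image hinj]
        rfl
    _ ≤ _ := by
        refine Finset.sum_le_sum_of_subset_of_nonneg (fun P hP => ?_) fun P _ _ => hx.1 P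
        obtain ⟨p, hp, rfl⟩ := Finset.mem_image.1 hP
        simp only [Finset.mem_filter, Finset.mem_univ, true_and] at hp ⊢
        exact hp.1

/-- A path with `r(P) < 0` has no temporal copies, so it contributes `0` on the right and at most
`0` on the left. -/
lemma le_sum_temporallyRepeated [Fintype Path] {x : Path → ℝ} (hx : ∀ P, 0 ≤ x P) :
    ∑ P, N.weight τ T P * x P ≤ ∑ p, N.temporallyRepeated τ T x p := by
  classical
  have h : ∑ p, N.temporallyRepeated τ T x p =
      ∑ q : Path × Fin T, if (q.2 : ℕ) + ∑ e ∈ N.elems q.1, τ e < T then x q.1 else 0 := by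
    rw [← Finset.sum_filter]
    exact (Finset.sum_subtype _ (by simp) (fun q : Path × Fin T => x q.1)).symm
  rw [h, Fintype.sum_prod_type]
  refine Finset.sum_le_sum fun P _ => ?_
  dsimp only
  rw [← Finset.sum_filter, Finset.sum_const, nsmul_eq_mul]
  refine mul_le_mul_of_nonneg_right ?_ (hx P)
  have hcard : T - ∑ e ∈ N.elems P, τ e ≤
      (Finset.univ.filter fun t : Fin T => (t : ℕ) + ∑ e ∈ N.elems P, τ e < T).card := by
    rw [← Finset.card_range (T - ∑ e ∈ N.elems P, τ e)]
    refine Finset.card_le_card_of_surjOn (fun t : Fin T => (t : ℕ)) fun t ht => ?_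
    have : t < T - ∑ e ∈ N.elems P, τ e := by simpa using ht
    exact ⟨⟨t, by omega⟩, by simp; omega, rfl⟩
  rw [Nat.sub_le_iff_le_add] at hcard
  have : (T : ℝ) ≤ _ := Nat.cast_le.2 hcard
  push_cast at this
  simp only [weight]
  linarith

end OverTime

end AbstractNetwork

theorem mainTheorem1 {E Path : Type*} [Fintype E] [Fintype Path] (N : AbstractNetwork E Path)
    (hN : ∀ P, (N.elems P).Nonempty) (c : E → ℝ) (hc : ∀ e, 0 ≤ c e) (τ : E → ℕ) (T : ℕ) :
    -- a maximum flow over time and a minimum cut over time exist, and their values agree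
    (∃ x C, N.IsMaxFlowOverTime c τ T x ∧ N.IsMinCutOverTime c τ T C ∧
      ∑ p, x p = ∑ z ∈ C, c z.1) ∧
    -- the weights of the static problem are supermodular
    N.IsSupermodular (N.weight τ T) ∧
    -- the static problem has an optimal solution, and an integral optimal dual solution
    (∃ x, N.IsMaxWeightedFlow c (N.weight τ T) x) ∧
    (∃ y : E → ℕ, N.IsMinWeightedCut c (N.weight τ T) (fun e => (y e : ℝ))) ∧
    -- every optimal static flow yields a maximum flow over time by temporal repetition
    (∀ x, N.IsMaxWeightedFlow c (N.weight τ T) x →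
      N.IsMaxFlowOverTime c τ T (N.temporallyRepeated τ T x) ∧
      ∑ p, N.temporallyRepeated τ T x p = ∑ P, N.weight τ T P * x P) ∧
    -- every integral optimal dual solution yields a minimum cut over time
    (∀ y : E → ℕ, N.IsMinWeightedCut c (N.weight τ T) (fun e => (y e : ℝ)) →
      N.IsMinCutOverTime c τ T (N.cutOverTime τ T y) ∧
      ∑ z ∈ N.cutOverTime τ T y, c z.1 = ∑ e, c e * (y e : ℝ)) := by
  classical
  obtain ⟨y₀, hy₀⟩ := AbstractNetwork.exists_nat_isMinWeightedCut hN hc τ T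
  obtain ⟨x₀, hx₀, hval⟩ := hy₀.exists_isFlow hN hc
  have hx₀max : N.IsMaxWeightedFlow c (N.weight τ T) x₀ :=
    ⟨hx₀, fun x' hx' => (hx'.value_le hy₀.1).trans hval.ge⟩
  have sandwich : ∀ (x : Path → ℝ) (y : E → ℕ), N.IsMaxWeightedFlow c (N.weight τ T) x →
      N.IsMinWeightedCut c (N.weight τ T) (fun e => (y e : ℝ)) →
      N.IsMaxFlowOverTime c τ T (N.temporallyRepeated τ T x) ∧
      N.IsMinCutOverTime c τ T (N.cutOverTime τ T y) ∧
      ∑ p, N.temporallyRepeated τ T x p = ∑ P, N.weight τ T P * x P ∧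
      ∑ z ∈ N.cutOverTime τ T y, c z.1 = ∑ e, c e * (y e : ℝ) ∧
      ∑ p, N.temporallyRepeated τ T x p = ∑ z ∈ N.cutOverTime τ T y, c z.1 := by
    intro x y hx hy
    have hflow := AbstractNetwork.isFlowOverTime_temporallyRepeated (τ := τ) (T := T) hx.1
    have hcut := AbstractNetwork.isCutOverTime_cutOverTime hN hy.1
    have h1 := AbstractNetwork.le_sum_temporallyRepeated (N := N) (τ := τ) (T := T) hx.1.1
    have h2 := hflow.value_le hcut
    have h3 := AbstractNetwork.sum_cutOverTime_le (N := N) (τ := τ) (T := T) hc y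
    have h4 := hx.2 x₀ hx₀
    have h5 := hy.2 _ hy₀.1
    -- `h1`, `h2`, `h3` bound the static value of `x` by the dual value of `y`; `h4`, `h5` and
    -- `hval` close the chain, so all of these are equalities.
    refine ⟨⟨hflow, fun x' hx' => ?_⟩, ⟨hcut, fun C' hC' => ?_⟩, ?_, ?_, ?_⟩
    · linarith [hx'.value_le hcut]
    · linarith [hflow.value_le hC']
    all_goals linarith
  have h₀ := sandwich x₀ y₀ hx₀max hy₀
  exact ⟨⟨_, _, h₀.1, h₀.2.1, h₀.2.2.2.2⟩, N.isSupermodular_weight τ T, ⟨x₀, hx₀max⟩, ⟨y₀, hy₀⟩,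
    fun x hx => ⟨(sandwich x y₀ hx hy₀).1, (sandwich x y₀ hx hy₀).2.2.1⟩,
    fun y hy => ⟨(sandwich x₀ y hx₀max hy).2.1, (sandwich x₀ y hx₀max hy).2.2.2.1⟩⟩
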